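/- There is an absolute constant $c>0$ such that for all nonnegative integers $n$ and $k$ with $k\le n/2$, every quantum query algorithm in the adjacency matrix model that decides with bounded error whether an $n$-vertex simple undirected graph $G$ has a matching with at least $k$ edges makes at least $c\sqrt{k}\,n$ queries; that is, the bounded-error quantum query complexity of this problem is $\Omega(\sqrt{k}\,n)$. Here a quantum query algorithm with $T$ queries applies $U_0, O_G, U_1, O_G, \dots, O_G, U_T$ to a fixed initial basis state of a finite-dimensional state space and then measures in the computational basis, the output bit being a function of the measurement outcome; the $U_i$ are arbitrary unitary operators independent of $G$, and the oracle $O_G$, which may be applied conditionally and to only a part of the state space, acts by $O_G|\{u,v\}\rangle|q\rangle = |\{u,v\}\rangle|q\oplus E_G(u,v)\rangle$ for distinct vertices $u,v$ and $q\in\{0,1\}$, where $E_G(u,v)=1$ if $\{u,v\}$ is an edge of $G$ and $E_G(u,v)=0$ otherwise. The algorithm decides the property with bounded error if, for every $n$-vertex graph $G$, its output is correct with probability at least $2/3$. -/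

import Mathlib

noncomputable section

namespace QuantumQuery

/-- Labels of the computational basis: a query register holding an index `i : I` of the input
(or the idle value `none`, on which the oracle acts trivially, so that the oracle may be applied
conditionally), a target bit, and a work register of dimension `d`. -/
abbrev BasisLabel (I : Type) (d : ℕ) : Type := Option I × Bool × Fin d

/-- The action of the oracle for the input `x` on basis labels:
`(i, q, w) ↦ (i, q ⊕ x i, w)`. -/
def oracleLabel {I : Type} {d : ℕ} (x : I → Bool) : BasisLabel I d → BasisLabel I d
  | (some i, q, w) => (some i, Bool.xor q (x i), w)
  | (none, q, w) => (none, q, w)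

/-- The oracle operator for the input `x`, as a matrix in the computational basis:
it sends the basis vector with label `b` to the basis vector with label `oracleLabel x b`. -/
def oracleMatrix {I : Type} [DecidableEq I] {d : ℕ} (x : I → Bool) :
    Matrix (BasisLabel I d) (BasisLabel I d) ℂ :=
  Matrix.of fun a b => if a = oracleLabel x b then 1 else 0

/-- A quantum query algorithm with a one-bit output, for inputs `x : I → Bool`: it applies
`U 0`, oracle, `U 1`, oracle, …, oracle, `U T` to a fixed basis state, where the unitaries do not
depend on the input, and then measures in the computational basis and outputs a bit that is a
function of the measurement result. -/
structure Algorithm (I : Type) [Fintype I] [DecidableEq I] where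
  /-- The number of oracle calls. -/
  queries : ℕ
  /-- The dimension of the work register. -/
  workDim : ℕ
  /-- The label of the initial basis state. -/
  start : BasisLabel I workDim
  /-- The input-independent unitaries `U 0, …, U T`. -/
  U : Fin (queries + 1) → Matrix.unitaryGroup (BasisLabel I workDim) ℂ
  /-- The output as a function of the result of the final measurement. -/
  output : BasisLabel I workDim → Bool

namespace Algorithm

variable {I : Type} [Fintype I] [DecidableEq I]

/-- The state of the algorithm on input `x` after `U t` has been applied, i.e. the vector
`U t · O · U (t - 1) · ⋯ · O · U 0 · |start⟩`. -/
def state (A : Algorithm I) (x : I → Bool) (t : Fin (A.queries + 1)) :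
    BasisLabel I A.workDim → ℂ :=
  Fin.induction (motive := fun _ => BasisLabel I A.workDim → ℂ)
    ((A.U 0).val.mulVec (Pi.single A.start 1))
    (fun s ψ => (A.U s.succ).val.mulVec ((oracleMatrix x).mulVec ψ)) t

/-- The final state of the algorithm on input `x`. -/
def finalState (A : Algorithm I) (x : I → Bool) : BasisLabel I A.workDim → ℂ :=
  A.state x (Fin.last A.queries)

/-- The probability that the algorithm outputs the bit `b` on input `x`. -/
def outputProb (A : Algorithm I) (x : I → Bool) (b : Bool) : ℝ :=
  ∑ a : BasisLabel I A.workDim, if A.output a = b then ‖A.finalState x a‖ ^ 2 else 0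

end Algorithm

/-- Unordered pairs of distinct elements of `V`. -/
abbrev VertexPair (V : Type) : Type := {e : Sym2 V // ¬ e.IsDiag}

open Classical in
/-- The adjacency matrix oracle of a graph. -/
def adjacencyOracle {V : Type} (G : SimpleGraph V) : VertexPair V → Bool :=
  fun e => decide (e.val ∈ G.edgeSet)

/-- The graph `G` on a finite vertex set has a matching with at least `k` edges. -/
def HasMatchingOfSize {V : Type} [Finite V] (G : SimpleGraph V) (k : ℕ) : Prop :=
  ∃ M : G.Subgraph, M.IsMatching ∧ k ≤ M.edgeSet.ncard

open Classical in
/-- The quantum query algorithm `A`, in the adjacency matrix model, decides the graph property `P`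
with bounded error: on every graph its output is correct with probability at least `2/3`. -/
def DecidesWithBoundedError {V : Type} [Fintype V] [DecidableEq V]
    (A : Algorithm (VertexPair V)) (P : SimpleGraph V → Prop) : Prop :=
  ∀ G : SimpleGraph V, 2 / 3 ≤ A.outputProb (adjacencyOracle G) (decide (P G))

end QuantumQuery

end

/-! The proof is a weighted quantum adversary argument. On a pair of one rejected and one accepted
input, the two states start with overlap 1 and must end with overlap at most 17/18. Only oracle
calls change the overlap, by an amount controlled by the query mass on the bits where the inputs
differ, so a family of pairs in which every single bit rarely differs forces many queries
(`Algorithm.adversary_bound`). The "rarely" is checked by counting, for one input and one bit, the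
partners that differ there (`Algorithm.symmetrized_adversary_bound`); `s` balances one-bits, which
differ often, against zero-bits.

Two families cover all parameters. If `4 * k ≤ n`, compare `k` disjoint edges with the same edges
minus one: the missing edge could sit in about `n ^ 2` places, which gives order `√k * n`
(`sqrt_mul_le_queries_of_pairsGraph`). Otherwise `n` and `k` are comparable: compare a cycle of
length `2 * k`, which has a perfect matching, with two disjoint odd cycles on the same vertices,
which have none. Composing the long cycle with a transposition produces the two cycles, and rotating
them independently shows how many ways lead back; this gives order `k * √k`
(`sqrt_mul_le_queries_of_permGraph`, `sqrt_mul_le_queries_of_cycles`). -/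

namespace QuantumQuery

/-! ### Effect of one oracle call on the overlap of two states -/

variable {I : Type}

/-- The squared norm of the part of a state whose query register holds `i`. -/
noncomputable def queryMass {d : ℕ} (ψ : BasisLabel I d → ℂ) (i : I) : ℝ :=
  ∑ q : Bool, ∑ w : Fin d, ‖ψ (some i, q, w)‖ ^ 2

/-- The weight of an input bit: `s⁻¹` for a one and `s` for a zero. -/
noncomputable def bitWeight (s : ℝ) (b : Bool) : ℝ := if b then s⁻¹ else s

theorem queryMass_nonneg {d : ℕ} (ψ : BasisLabel I d → ℂ) (i : I) : 0 ≤ queryMass ψ i := by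
  unfold queryMass; positivity

theorem sum_queryMass_le [Fintype I] {d : ℕ} (ψ : BasisLabel I d → ℂ) :
    ∑ i, queryMass ψ i ≤ ∑ a, ‖ψ a‖ ^ 2 := by
  rw [Fintype.sum_prod_type, Fintype.sum_option]
  simp only [Fintype.sum_prod_type, queryMass]
  have : 0 ≤ ∑ q : Bool, ∑ w : Fin d, ‖ψ (none, q, w)‖ ^ 2 := by positivity
  linarith

theorem oracleLabel_involutive {d : ℕ} (x : I → Bool) :
    Function.Involutive (oracleLabel (d := d) x) := by
  rintro ⟨_ | i, q, w⟩ <;> simp [oracleLabel]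

theorem oracleMatrix_mulVec [Fintype I] [DecidableEq I] {d : ℕ} (x : I → Bool)
    (ψ : BasisLabel I d → ℂ) (a : BasisLabel I d) :
    (oracleMatrix x).mulVec ψ a = ψ (oracleLabel x a) := by
  have h : ∀ b, (a = oracleLabel x b) ↔ (b = oracleLabel x a) := fun b =>
    ⟨fun h => by rw [h, oracleLabel_involutive], fun h => by rw [h, oracleLabel_involutive]⟩
  simp [Matrix.mulVec, dotProduct, oracleMatrix, h]

theorem norm_star_mul_le (s : ℝ) (hs : 0 < s) (u v : ℂ) :
    ‖star u * v‖ ≤ (s * ‖u‖ ^ 2 + s⁻¹ * ‖v‖ ^ 2) / 2 := by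
  rw [norm_mul, norm_star]
  have h : s * ‖u‖ ^ 2 + s⁻¹ * ‖v‖ ^ 2 - 2 * (‖u‖ * ‖v‖) = s⁻¹ * (s * ‖u‖ - ‖v‖) ^ 2 := by
    field_simp; ring
  have : 0 ≤ s⁻¹ * (s * ‖u‖ - ‖v‖) ^ 2 := by positivity
  linarith

theorem norm_swapped_overlap_sub_le {d : ℕ} (s : ℝ) (hs : 0 < s) (u₀ u₁ v₀ v₁ : Fin d → ℂ) :
    ‖(∑ w, star (u₀ w) * v₁ w + ∑ w, star (u₁ w) * v₀ w) -
      (∑ w, star (u₀ w) * v₀ w + ∑ w, star (u₁ w) * v₁ w)‖ ≤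
    s * (∑ w, ‖u₀ w‖ ^ 2 + ∑ w, ‖u₁ w‖ ^ 2) + s⁻¹ * (∑ w, ‖v₀ w‖ ^ 2 + ∑ w, ‖v₁ w‖ ^ 2) := by
  have key : ∀ u v : Fin d → ℂ, ‖∑ w, star (u w) * v w‖ ≤
      (s * ∑ w, ‖u w‖ ^ 2 + s⁻¹ * ∑ w, ‖v w‖ ^ 2) / 2 := by
    intro u v
    refine (norm_sum_le _ _).trans ?_
    rw [Finset.mul_sum, Finset.mul_sum, ← Finset.sum_add_distrib, Finset.sum_div]
    exact Finset.sum_le_sum fun w _ => norm_star_mul_le s hs _ _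
  refine (norm_sub_le _ _).trans ((add_le_add (norm_add_le _ _) (norm_add_le _ _)).trans ?_)
  linarith [key u₀ v₁, key u₁ v₀, key u₀ v₀, key u₁ v₁]

/-- Where the inputs agree, both oracles permute the coordinates alike and the contribution cancels.
Where they differ, one target bit is flipped relative to the other, and the cross terms are split by
weighted AM-GM, the input holding a zero receiving `s` and the one holding a one receiving `s⁻¹`. -/
theorem norm_overlap_oracle_sub_le [Fintype I] [DecidableEq I] {d : ℕ} (x y : I → Bool)
    (ψ φ : BasisLabel I d → ℂ) (s : ℝ) (hs : 0 < s) :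
    ‖star ((oracleMatrix x).mulVec ψ) ⬝ᵥ ((oracleMatrix y).mulVec φ) - star ψ ⬝ᵥ φ‖ ≤
      ∑ i, if x i ≠ y i then
        bitWeight s (x i) * queryMass ψ i + bitWeight s (y i) * queryMass φ i else 0 := by
  simp only [dotProduct, Pi.star_apply, oracleMatrix_mulVec]
  rw [Fintype.sum_prod_type, Fintype.sum_prod_type, Fintype.sum_option, Fintype.sum_option]
  simp only [oracleLabel, add_sub_add_left_eq_sub, ← Finset.sum_sub_distrib]
  refine (norm_sum_le _ _).trans (Finset.sum_le_sum fun i _ => ?_)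
  simp only [Fintype.sum_prod_type, Fintype.sum_bool, queryMass, bitWeight]
  have h1 := norm_swapped_overlap_sub_le s hs (fun w => ψ (some i, false, w))
    (fun w => ψ (some i, true, w)) (fun w => φ (some i, false, w)) (fun w => φ (some i, true, w))
  -- `h1` serves the case where `x` has the zero; with the roles reversed the weights are inverted.
  have h2 := norm_swapped_overlap_sub_le s⁻¹ (inv_pos.2 hs) (fun w => ψ (some i, false, w))
    (fun w => ψ (some i, true, w)) (fun w => φ (some i, false, w)) (fun w => φ (some i, true, w))
  rw [inv_inv] at h2
  cases hx : x i <;> cases hy : y i <;> simp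
  · refine le_trans (le_of_eq ?_) (h1.trans (le_of_eq ?_))
    · congr 1; simp; ring
    · ring
  · refine le_trans (le_of_eq ?_) (h2.trans (le_of_eq ?_))
    · congr 1; simp; ring
    · ring

theorem star_mulVec_dotProduct_mulVec {m : Type} [Fintype m] [DecidableEq m]
    (U : Matrix.unitaryGroup m ℂ) (ψ φ : m → ℂ) :
    star (U.val.mulVec ψ) ⬝ᵥ U.val.mulVec φ = star ψ ⬝ᵥ φ := by
  have h : star U.val * U.val = 1 := Matrix.mem_unitaryGroup_iff'.1 U.2
  rw [Matrix.star_mulVec, ← Matrix.star_eq_conjTranspose, Matrix.dotProduct_mulVec,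
    Matrix.vecMul_vecMul, h, Matrix.vecMul_one]

theorem star_dotProduct_self_eq {m : Type} [Fintype m] (ψ : m → ℂ) :
    star ψ ⬝ᵥ ψ = ((∑ a, ‖ψ a‖ ^ 2 : ℝ) : ℂ) := by
  simp [dotProduct, Complex.conj_mul']

/-! ### The adversary bound -/

namespace Algorithm

variable [Fintype I] [DecidableEq I]

theorem state_zero (A : Algorithm I) (x : I → Bool) :
    A.state x 0 = (A.U 0).val.mulVec (Pi.single A.start 1) := rfl

theorem state_succ (A : Algorithm I) (x : I → Bool) (t : Fin A.queries) :
    A.state x t.succ =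
      (A.U t.succ).val.mulVec ((oracleMatrix x).mulVec (A.state x t.castSucc)) := rfl

theorem overlap_state_succ (A : Algorithm I) (x y : I → Bool) (t : Fin A.queries) :
    star (A.state x t.succ) ⬝ᵥ A.state y t.succ =
      star ((oracleMatrix x).mulVec (A.state x t.castSucc)) ⬝ᵥ
        ((oracleMatrix y).mulVec (A.state y t.castSucc)) := by
  rw [state_succ, state_succ, star_mulVec_dotProduct_mulVec]

theorem overlap_state_zero (A : Algorithm I) (x y : I → Bool) :
    star (A.state x 0) ⬝ᵥ A.state y 0 = 1 := by
  rw [state_zero, state_zero, star_mulVec_dotProduct_mulVec]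
  simp [dotProduct, Pi.single_apply]

theorem sum_norm_sq_state (A : Algorithm I) (x : I → Bool) (t : Fin (A.queries + 1)) :
    ∑ a, ‖A.state x t a‖ ^ 2 = 1 := by
  have h : star (A.state x t) ⬝ᵥ A.state x t = 1 := by
    induction t using Fin.induction with
    | zero => exact overlap_state_zero A x x
    | succ t ih =>
      rw [overlap_state_succ, ← ih]
      simp only [dotProduct, Pi.star_apply, oracleMatrix_mulVec]
      exact (oracleLabel_involutive x).bijective.sum_comp
        (fun a => star (A.state x t.castSucc a) * A.state x t.castSucc a)
  rw [star_dotProduct_self_eq] at h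
  exact_mod_cast h

theorem outputProb_true_add_false (A : Algorithm I) (x : I → Bool) :
    A.outputProb x true + A.outputProb x false = 1 := by
  rw [← A.sum_norm_sq_state x (Fin.last _), outputProb, outputProb, ← Finset.sum_add_distrib]
  refine Finset.sum_congr rfl fun a _ => ?_
  cases A.output a <;> simp [finalState]

theorem norm_overlap_finalState_le (A : Algorithm I) (x y : I → Bool)
    (hx : 2 / 3 ≤ A.outputProb x false) (hy : 2 / 3 ≤ A.outputProb y true) :
    ‖star (A.finalState x) ⬝ᵥ A.finalState y‖ ≤ 17 / 18 := by
  have h : ‖star (A.finalState x) ⬝ᵥ A.finalState y‖ ≤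
      (3 / 2 * A.outputProb x true + 2 / 3 * A.outputProb y true +
        (2 / 3 * A.outputProb x false + 3 / 2 * A.outputProb y false)) / 2 := by
    refine (norm_sum_le _ _).trans ?_
    simp only [outputProb, Finset.mul_sum, ← Finset.sum_add_distrib, Finset.sum_div]
    refine Finset.sum_le_sum fun a _ => ?_
    -- On each outcome the larger weight 3/2 goes to the input for which that output is wrong. At
    -- error 1/3 the total is `2 * (3/2 * 1/3 + 2/3 * 2/3) / 2 = 17/18`.
    have h1 := norm_star_mul_le (3 / 2) (by norm_num) (A.finalState x a) (A.finalState y a)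
    have h2 := norm_star_mul_le (2 / 3) (by norm_num) (A.finalState x a) (A.finalState y a)
    rw [Pi.star_apply]
    cases A.output a
    · refine h2.trans (le_of_eq ?_); simp
    · refine h1.trans (le_of_eq ?_); simp
  have := A.outputProb_true_add_false x
  have := A.outputProb_true_add_false y
  linarith

/-- The positive weight adversary bound for a family of pairs consisting of a rejected input `x ω`
and an accepted input `y ω`. -/
theorem adversary_bound (A : Algorithm I) {Ω : Type} [Fintype Ω] [Nonempty Ω]
    (x y : Ω → I → Bool) (s ε : ℝ) (hs : 0 < s) (hε : 0 < ε)
    (hx : ∀ ω, 2 / 3 ≤ A.outputProb (x ω) false) (hy : ∀ ω, 2 / 3 ≤ A.outputProb (y ω) true)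
    (hX : ∀ f : (I → Bool) → I → ℝ, (∀ z i, 0 ≤ f z i) →
      ∑ ω, ∑ i, (if x ω i ≠ y ω i then bitWeight s (x ω i) * f (x ω) i else 0) ≤
        ε * ∑ ω, ∑ i, f (x ω) i)
    (hY : ∀ f : (I → Bool) → I → ℝ, (∀ z i, 0 ≤ f z i) →
      ∑ ω, ∑ i, (if x ω i ≠ y ω i then bitWeight s (y ω i) * f (y ω) i else 0) ≤
        ε * ∑ ω, ∑ i, f (y ω) i) :
    1 / (36 * ε) ≤ (A.queries : ℝ) := by
  have hcard : (0 : ℝ) < Fintype.card Ω := by exact_mod_cast Fintype.card_pos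
  have mass : ∀ (u : Ω → I → Bool) (t : Fin (A.queries + 1)),
      ∑ ω, ∑ i, queryMass (A.state (u ω) t) i ≤ Fintype.card Ω := by
    intro u t
    calc _ ≤ ∑ _ω : Ω, (1 : ℝ) := Finset.sum_le_sum fun ω _ =>
          (sum_queryMass_le _).trans (A.sum_norm_sq_state (u ω) t).le
      _ = _ := by simp
  -- One query moves the summed overlaps by at most `ε * card Ω` from the rejected side (`hX`) plus
  -- the same from the accepted side (`hY`).
  have step : ∀ t : Fin A.queries,
      ∑ ω, ‖star (A.state (x ω) t.succ) ⬝ᵥ A.state (y ω) t.succ -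
        star (A.state (x ω) t.castSucc) ⬝ᵥ A.state (y ω) t.castSucc‖ ≤
      2 * ε * Fintype.card Ω := by
    intro t
    have h1 := (hX (fun z i => queryMass (A.state z t.castSucc) i)
      (fun _ _ => queryMass_nonneg _ _)).trans
      (mul_le_mul_of_nonneg_left (mass x t.castSucc) hε.le)
    have h2 := (hY (fun z i => queryMass (A.state z t.castSucc) i)
      (fun _ _ => queryMass_nonneg _ _)).trans
      (mul_le_mul_of_nonneg_left (mass y t.castSucc) hε.le)
    refine le_trans ?_ ((add_le_add h1 h2).trans (le_of_eq (by ring)))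
    rw [← Finset.sum_add_distrib]
    refine Finset.sum_le_sum fun ω _ => ?_
    rw [overlap_state_succ, ← Finset.sum_add_distrib]
    refine (norm_overlap_oracle_sub_le _ _ _ _ s hs).trans (le_of_eq ?_)
    refine Finset.sum_congr rfl fun i _ => ?_
    split_ifs <;> simp
  have total : ∀ t : Fin (A.queries + 1),
      ∑ ω, ‖star (A.state (x ω) t) ⬝ᵥ A.state (y ω) t - 1‖ ≤
        (t : ℝ) * (2 * ε * Fintype.card Ω) := by
    intro t
    induction t using Fin.induction with
    | zero => simp [overlap_state_zero]
    | succ t ih =>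
      have : ((t.succ : Fin (A.queries + 1)) : ℝ) * (2 * ε * Fintype.card Ω) =
          (t : ℝ) * (2 * ε * Fintype.card Ω) + 2 * ε * Fintype.card Ω := by
        push_cast [Fin.val_succ]; ring
      rw [this, add_comm]
      refine le_trans ?_ (add_le_add (step t) ih)
      rw [← Finset.sum_add_distrib]
      refine Finset.sum_le_sum fun ω _ => ?_
      refine le_trans (le_of_eq ?_) (norm_add_le _ _)
      congr 1; ring
  -- Every pair must lose at least `1 - 17/18` of its overlap; dividing by `2 * ε` gives the
  -- constant 36.
  have final : ∑ _ω : Ω, (1 / 18 : ℝ) ≤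
      ∑ ω, ‖star (A.finalState (x ω)) ⬝ᵥ A.finalState (y ω) - 1‖ := by
    refine Finset.sum_le_sum fun ω _ => ?_
    have h1 := A.norm_overlap_finalState_le _ _ (hx ω) (hy ω)
    have h2 := norm_sub_norm_le (1 : ℂ) (star (A.finalState (x ω)) ⬝ᵥ A.finalState (y ω))
    rw [norm_sub_rev, norm_one] at h2
    linarith
  have h := final.trans (total (Fin.last _))
  simp only [Finset.sum_const, Finset.card_univ, nsmul_eq_mul, Fin.val_last] at h
  rw [div_le_iff₀ (by positivity)]
  have : (Fintype.card Ω : ℝ) * 1 ≤ Fintype.card Ω * (A.queries * (36 * ε)) := by nlinarith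
  exact le_of_mul_le_mul_left this hcard

end Algorithm

/-! ### Reducing the weight conditions to counting -/

variable [Fintype I]

/-- Reparametrising `Ω` by `g r` leaves the sum unchanged on average and keeps `x`, so the indicator
that a bit differs may be replaced by the fraction of `r` for which it differs, with `x ω` and the
bit fixed. -/
theorem sum_weight_le_of_averaging {Ω R : Type} [Fintype Ω] [Fintype R] [Nonempty R]
    (x y : Ω → I → Bool) (g : R → Ω → Ω) (s ε : ℝ)
    (hg : ∀ F : Ω → ℝ, ∑ r, ∑ ω, F (g r ω) = Fintype.card R * ∑ ω, F ω)
    (hx : ∀ r ω, x (g r ω) = x ω)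
    (hc : ∀ ω i, bitWeight s (x ω i) * (Finset.univ.filter fun r => x ω i ≠ y (g r ω) i).card ≤
      ε * Fintype.card R)
    (f : (I → Bool) → I → ℝ) (hf : ∀ z i, 0 ≤ f z i) :
    ∑ ω, ∑ i, (if x ω i ≠ y ω i then bitWeight s (x ω i) * f (x ω) i else 0) ≤
      ε * ∑ ω, ∑ i, f (x ω) i := by
  have hcard : (0 : ℝ) < Fintype.card R := by exact_mod_cast Fintype.card_pos
  refine le_of_mul_le_mul_left ?_ hcard
  rw [← hg, Finset.sum_comm]
  simp only [hx, Finset.mul_sum]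
  refine Finset.sum_le_sum fun ω _ => ?_
  rw [Finset.sum_comm]
  refine Finset.sum_le_sum fun i _ => ?_
  rw [← Finset.sum_filter, Finset.sum_const, nsmul_eq_mul]
  have := mul_le_mul_of_nonneg_right (hc ω i) (hf (x ω) i)
  linarith

/-- The adversary bound for a family of pairs indexed by a group and a set of modifications, where
the rejected inputs are averaged over translations of the group. -/
theorem Algorithm.symmetrized_adversary_bound [DecidableEq I] (A : Algorithm I) {H Λ R : Type}
    [Group H] [Fintype H] [Fintype Λ] [Nonempty Λ] [Fintype R] [Nonempty R]
    (x : H → Λ → I → Bool) (y : H → I → Bool) (ρ : Λ → R → H) (s ε : ℝ) (hs : 0 < s) (hε : 0 < ε)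
    (hx : ∀ σ l, 2 / 3 ≤ A.outputProb (x σ l) false)
    (hy : ∀ σ, 2 / 3 ≤ A.outputProb (y σ) true)
    (hρ : ∀ σ l r, x (σ * ρ l r) l = x σ l)
    (hX : ∀ σ l i, bitWeight s (x σ l i) *
      (Finset.univ.filter fun r => x σ l i ≠ y (σ * ρ l r) i).card ≤ ε * Fintype.card R)
    (hY : ∀ σ i, bitWeight s (y σ i) *
      (Finset.univ.filter fun l => y σ i ≠ x σ l i).card ≤ ε * Fintype.card Λ) :
    1 / (36 * ε) ≤ (A.queries : ℝ) := by
  refine A.adversary_bound (Ω := H × Λ) (fun ω => x ω.1 ω.2) (fun ω => y ω.1) s ε hs hε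
    (fun ω => hx _ _) (fun ω => hy _) ?_ ?_
  · refine sum_weight_le_of_averaging _ _ (fun (r : R) ω => (ω.1 * ρ ω.2 r, ω.2)) s ε ?_
      (fun r ω => hρ _ _ _) (fun ω i => hX _ _ _)
    intro F
    -- For fixed `l`, right translation by `ρ l r` is a bijection of the group.
    have h : ∀ r : R, ∑ ω : H × Λ, F (ω.1 * ρ ω.2 r, ω.2) = ∑ ω, F ω := by
      intro r
      rw [Fintype.sum_prod_type_right, Fintype.sum_prod_type_right]
      exact Finset.sum_congr rfl fun l _ =>
        Equiv.sum_comp (Equiv.mulRight (ρ l r)) (fun σ => F (σ, l))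
    simp [h]
  · simp only [ne_comm (a := x _ _ _)]
    refine sum_weight_le_of_averaging (fun ω : H × Λ => y ω.1) (fun ω => x ω.1 ω.2)
      (fun (l : Λ) ω => (ω.1, l)) s ε ?_ (fun r ω => rfl) (fun ω i => hY _ _)
    intro F
    simp only [Fintype.sum_prod_type, Finset.sum_const, Finset.card_univ, nsmul_eq_mul]
    rw [Finset.sum_comm, Finset.mul_sum]
    simp only [Finset.mul_sum]

/-! ### Certificates for having and not having a large matching -/

section Matching

variable {V : Type} {G : SimpleGraph V}

theorem hasMatchingOfSize_of_adj [Finite V] {k : ℕ} (a b : Fin k → V)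
    (hab : Function.Injective (Sum.elim a b)) (h : ∀ s, G.Adj (a s) (b s)) :
    HasMatchingOfSize G k := by
  have ha : ∀ s t, a s = a t → s = t := fun s t e => Sum.inl_injective (hab (by simpa using e))
  have hb : ∀ s t, b s = b t → s = t := fun s t e => Sum.inr_injective (hab (by simpa using e))
  have hne : ∀ s t, a s ≠ b t := fun s t e => by
    have := @hab (Sum.inl s) (Sum.inr t) (by simpa using e)
    simp at this
  refine ⟨⨆ s, G.subgraphOfAdj (h s), SimpleGraph.Subgraph.IsMatching.iSup
    (fun s => SimpleGraph.Subgraph.IsMatching.subgraphOfAdj (h s)) ?_, ?_⟩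
  · intro s t hst
    change Disjoint (G.subgraphOfAdj (h s)).support (G.subgraphOfAdj (h t)).support
    rw [SimpleGraph.support_subgraphOfAdj, SimpleGraph.support_subgraphOfAdj,
      Set.disjoint_left]
    rintro v (rfl | rfl) (e | e)
    · exact hst (ha _ _ e)
    · exact hne _ _ e
    · exact hne _ _ e.symm
    · exact hst (hb _ _ e)
  · rw [SimpleGraph.Subgraph.edgeSet_iSup]
    have : Set.range (fun s => s(a s, b s)) ⊆ ⋃ s, (G.subgraphOfAdj (h s)).edgeSet := by
      rintro _ ⟨s, rfl⟩
      exact Set.mem_iUnion.2 ⟨s, by simp⟩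
    refine le_trans ?_ (Set.ncard_le_ncard this (Set.toFinite _))
    rw [Set.ncard_range_of_injective, Nat.card_fin]
    intro s t e
    rcases Sym2.eq_iff.1 e with e | e
    · exact ha _ _ e.1
    · exact absurd e.1 (hne _ _)

theorem not_hasMatchingOfSize_of_ncard_edgeSet_lt [Finite V] {k : ℕ} (h : G.edgeSet.ncard < k) :
    ¬ HasMatchingOfSize G k := by
  rintro ⟨M, -, hk⟩
  have := Set.ncard_le_ncard M.edgeSet_subset (Set.toFinite _)
  omega

/-- Handshake lemma in `M.coe`, where all degrees are 1. -/
theorem ncard_verts_eq_two_mul_of_isMatching [Finite V] {M : G.Subgraph} (hM : M.IsMatching) :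
    M.verts.ncard = 2 * M.edgeSet.ncard := by
  classical
  have := Fintype.ofFinite V
  have h := M.coe.sum_degrees_eq_twice_card_edges
  have hd : ∀ (v : M.verts) [Fintype (M.coe.neighborSet v)], M.coe.degree v = 1 := fun v _ => by
    rw [SimpleGraph.Subgraph.coe_degree]
    exact SimpleGraph.Subgraph.degree_eq_one_iff_existsUnique_adj.2 (hM v.2)
  rw [← M.image_coe_edgeSet_coe, Set.ncard_image_of_injective _
    (Sym2.map.injective Subtype.val_injective), ← SimpleGraph.coe_edgeFinset, Set.ncard_coe_finset,
    ← h]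
  simp [hd, Set.ncard_eq_toFinset_card']

/-- All edges live on `W`, so `k` matching edges would saturate `W`. Since no edge leaves `S`, they
would restrict to a perfect matching of the odd set `S`. -/
theorem not_hasMatchingOfSize_of_odd [Finite V] {k : ℕ} (W S : Finset V) (hW : W.card ≤ 2 * k)
    (hGW : ∀ u v, G.Adj u v → u ∈ W) (hSW : S ⊆ W) (hS : Odd S.card)
    (hGS : ∀ u v, G.Adj u v → u ∈ S → v ∈ S) : ¬ HasMatchingOfSize G k := by
  classical
  rintro ⟨M, hM, hk⟩
  have hverts : M.verts ⊆ (W : Set V) := fun v hv => by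
    obtain ⟨w, hw, -⟩ := hM hv
    exact hGW _ _ hw.adj_sub
  have heq : M.verts = (W : Set V) := by
    refine Set.eq_of_subset_of_ncard_le hverts ?_ (Set.toFinite _)
    rw [Set.ncard_coe_finset, ncard_verts_eq_two_mul_of_isMatching hM]
    omega
  have hind : (M.induce (S : Set V)).IsMatching := by
    intro v hv
    obtain ⟨w, hw, huniq⟩ := hM (v := v) (by rw [heq]; exact hSW hv)
    exact ⟨w, ⟨hv, hGS _ _ hw.adj_sub hv, hw⟩, fun u hu => huniq u hu.2.2⟩
  have := ncard_verts_eq_two_mul_of_isMatching hind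
  rw [SimpleGraph.Subgraph.induce_verts, Set.ncard_coe_finset] at this
  rw [this] at hS
  exact (Nat.not_odd_iff_even.2 (even_two_mul _)) hS

end Matching

/-! ### Graphs of permutations and how a transposition changes them -/

section PermGraph

variable {V : Type}

/-- The graph whose edges join each element to its image under a permutation. -/
def permGraph (π : Equiv.Perm V) : SimpleGraph V := SimpleGraph.fromRel fun u v => π u = v

theorem permGraph_adj {π : Equiv.Perm V} {u v : V} :
    (permGraph π).Adj u v ↔ u ≠ v ∧ (π u = v ∨ π v = u) := SimpleGraph.fromRel_adj _ _ _

theorem card_filter_fst_eq_le {α : ℕ} (a : Fin α → V) (ha : a.Injective) [DecidableEq V] (u : V) :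
    (Finset.univ.filter fun r : Fin α × Fin α => a r.1 = u).card ≤ α := by
  have : (Finset.univ.filter fun r : Fin α × Fin α => a r.1 = u).card ≤
      (Finset.univ : Finset (Fin α)).card := by
    refine Finset.card_le_card_of_injOn Prod.snd (by simp) ?_
    rintro ⟨p, q⟩ h ⟨p', q'⟩ h' (rfl : q = q')
    simp only [Finset.coe_filter, Finset.mem_univ, true_and, Set.mem_ofPred_eq] at h h'
    rw [ha (h.trans h'.symm)]
  simpa using this

theorem card_filter_snd_eq_le {α : ℕ} (b : Fin α → V) (hb : b.Injective) [DecidableEq V] (u : V) :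
    (Finset.univ.filter fun r : Fin α × Fin α => b r.2 = u).card ≤ α := by
  have : (Finset.univ.filter fun r : Fin α × Fin α => b r.2 = u).card ≤
      (Finset.univ : Finset (Fin α)).card := by
    refine Finset.card_le_card_of_injOn Prod.fst (by simp) ?_
    rintro ⟨p, q⟩ h ⟨p', q'⟩ h' (rfl : p = p')
    simp only [Finset.coe_filter, Finset.mem_univ, true_and, Set.mem_ofPred_eq] at h h'
    rw [hb (h.trans h'.symm)]
  simpa using this

theorem card_filter_fst_eq_and_snd_eq_le {α : ℕ} (a b : Fin α → V) (ha : a.Injective)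
    (hb : b.Injective) [DecidableEq V] (u v : V) :
    (Finset.univ.filter fun r : Fin α × Fin α => a r.1 = u ∧ b r.2 = v).card ≤ 1 := by
  refine Finset.card_le_one.2 ?_
  simp only [Finset.mem_filter, Finset.mem_univ, true_and]
  rintro ⟨p, q⟩ h ⟨p', q'⟩ h'
  exact Prod.ext (ha (h.1.trans h'.1.symm)) (hb (h.2.trans h'.2.symm))

theorem card_filter_or_or_or_le {R : Type} [Fintype R] (p₁ p₂ p₃ p₄ : R → Prop)
    [DecidablePred p₁] [DecidablePred p₂] [DecidablePred p₃] [DecidablePred p₄] (m : ℕ)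
    (h₁ : (Finset.univ.filter p₁).card ≤ m) (h₂ : (Finset.univ.filter p₂).card ≤ m)
    (h₃ : (Finset.univ.filter p₃).card ≤ m) (h₄ : (Finset.univ.filter p₄).card ≤ m) :
    (Finset.univ.filter fun r => (p₁ r ∨ p₂ r) ∨ p₃ r ∨ p₄ r).card ≤ 4 * m := by
  classical
  rw [Finset.filter_or, Finset.filter_or, Finset.filter_or]
  refine (Finset.card_union_le _ _).trans ?_
  have := Finset.card_union_le (Finset.univ.filter p₁) (Finset.univ.filter p₂)
  have := Finset.card_union_le (Finset.univ.filter p₃) (Finset.univ.filter p₄)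
  omega

variable [DecidableEq V]

theorem permGraph_adj_mul_swap_of_ne {π : Equiv.Perm V} {a b u v : V} (hua : a ≠ u) (hva : a ≠ v)
    (hub : b ≠ u) (hvb : b ≠ v) : (permGraph (π * Equiv.swap a b)).Adj u v ↔
      (permGraph π).Adj u v := by
  simp [permGraph_adj, Equiv.swap_apply_of_ne_of_ne hua.symm hub.symm,
    Equiv.swap_apply_of_ne_of_ne hva.symm hvb.symm]

/-- To create the edge, the swap must exchange one endpoint with the preimage of the other, so a new
edge determines both swapped points up to four choices. -/
theorem adj_mul_swap_cases {π : Equiv.Perm V} {a b u v : V} (h : ¬ (permGraph π).Adj u v)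
    (h' : (permGraph (π * Equiv.swap a b)).Adj u v) :
    ((a = u ∧ b = π.symm v) ∨ (a = v ∧ b = π.symm u)) ∨
      (a = π.symm v ∧ b = u) ∨ (a = π.symm u ∧ b = v) := by
  rw [permGraph_adj] at h h'
  have key : ∀ u v, π u ≠ v → (π * Equiv.swap a b) u = v →
      (a = u ∧ b = π.symm v) ∨ (a = π.symm v ∧ b = u) := by
    intro u v huv e
    rw [Equiv.Perm.mul_apply] at e
    by_cases hua : u = a
    · subst hua; rw [Equiv.swap_apply_left] at e
      exact Or.inl ⟨rfl, by rw [← e, Equiv.symm_apply_apply]⟩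
    by_cases hub : u = b
    · subst hub; rw [Equiv.swap_apply_right] at e
      exact Or.inr ⟨by rw [← e, Equiv.symm_apply_apply], rfl⟩
    · rw [Equiv.swap_apply_of_ne_of_ne hua hub] at e
      exact absurd e huv
  obtain ⟨hne, e⟩ := h'
  have h1 : π u ≠ v := fun e => h ⟨hne, Or.inl e⟩
  have h2 : π v ≠ u := fun e => h ⟨hne, Or.inr e⟩
  rcases e with e | e
  · have := key u v h1 e; tauto
  · have := key v u h2 e; tauto

-- Any change at `u`, `v` needs one of the two swapped points to be `u` or `v`; each of these four
-- coincidences leaves one coordinate of `r` free.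
open Classical in
theorem card_filter_permGraph_adj_ne_le (π : Equiv.Perm V) {α : ℕ} (a b : Fin α → V)
    (ha : a.Injective) (hb : b.Injective) (u v : V) :
    (Finset.univ.filter fun r : Fin α × Fin α => ¬ ((permGraph π).Adj u v ↔
      (permGraph (π * Equiv.swap (a r.1) (b r.2))).Adj u v)).card ≤ 4 * α := by
  refine le_trans (Finset.card_le_card ?_) (card_filter_or_or_or_le
    (fun r : Fin α × Fin α => a r.1 = u) (fun r => a r.1 = v) (fun r => b r.2 = u)
    (fun r => b r.2 = v) α (card_filter_fst_eq_le a ha u) (card_filter_fst_eq_le a ha v)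
    (card_filter_snd_eq_le b hb u) (card_filter_snd_eq_le b hb v))
  intro r
  simp only [Finset.mem_filter, Finset.mem_univ, true_and]
  contrapose!
  rintro ⟨⟨h1, h2⟩, h3, h4⟩
  have := permGraph_adj_mul_swap_of_ne (π := π) h1 h2 h3 h4
  tauto

-- For a non-edge both coordinates of `r` are forced in each of the four cases, which saves a factor
-- `α` over the bound for edges.
open Classical in
theorem card_filter_permGraph_adj_ne_le_four (π : Equiv.Perm V) {α : ℕ} (a b : Fin α → V)
    (ha : a.Injective) (hb : b.Injective) (u v : V) (h : ¬ (permGraph π).Adj u v) :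
    (Finset.univ.filter fun r : Fin α × Fin α => ¬ ((permGraph π).Adj u v ↔
      (permGraph (π * Equiv.swap (a r.1) (b r.2))).Adj u v)).card ≤ 4 := by
  refine le_trans (Finset.card_le_card ?_) (card_filter_or_or_or_le
    (fun r : Fin α × Fin α => a r.1 = u ∧ b r.2 = π.symm v)
    (fun r => a r.1 = v ∧ b r.2 = π.symm u) (fun r => a r.1 = π.symm v ∧ b r.2 = u)
    (fun r => a r.1 = π.symm u ∧ b r.2 = v) 1 ?_ ?_ ?_ ?_)
  · intro r
    simp only [Finset.mem_filter, Finset.mem_univ, true_and]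
    intro h'
    exact adj_mul_swap_cases h (by tauto)
  all_goals exact card_filter_fst_eq_and_snd_eq_le a b ha hb _ _

end PermGraph

/-! ### Query bounds from the two hard families -/

section Families

variable {V : Type}

open Classical in
theorem adjacencyOracle_mk (G : SimpleGraph V) (u v : V) (h : ¬ s(u, v).IsDiag) :
    adjacencyOracle G ⟨s(u, v), h⟩ = decide (G.Adj u v) := by
  simp [adjacencyOracle]

theorem adjacencyOracle_mk_ne_iff (G G' : SimpleGraph V) (u v : V) (h : ¬ s(u, v).IsDiag) :
    adjacencyOracle G ⟨s(u, v), h⟩ ≠ adjacencyOracle G' ⟨s(u, v), h⟩ ↔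
      ¬ (G.Adj u v ↔ G'.Adj u v) := by
  simp [adjacencyOracle_mk]

theorem bitWeight_mul_card_permGraph_le [DecidableEq V] {α : ℕ} (hα : 0 < α)
    (π : Equiv.Perm V) (a b : Fin α → V) (ha : a.Injective) (hb : b.Injective) (e : VertexPair V) :
    bitWeight (√α) (adjacencyOracle (permGraph π) e) *
      (Finset.univ.filter fun r : Fin α × Fin α => adjacencyOracle (permGraph π) e ≠
        adjacencyOracle (permGraph (π * Equiv.swap (a r.1) (b r.2))) e).card ≤
      4 / (α * √α) * Fintype.card (Fin α × Fin α) := by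
  classical
  obtain ⟨e, he⟩ := e
  induction e using Sym2.ind with | _ u v => ?_
  simp only [adjacencyOracle_mk_ne_iff]
  have hα' : (0 : ℝ) < α := by exact_mod_cast hα
  have hs : 0 < √(α : ℝ) := Real.sqrt_pos.2 hα'
  have hsq : √(α : ℝ) * √(α : ℝ) = α := Real.mul_self_sqrt hα'.le
  -- The weight `√α` equalises the two cases: an edge costs `(√α)⁻¹ * (4 * α)`, a non-edge `√α * 4`.
  have hR : 4 / (α * √α) * (Fintype.card (Fin α × Fin α) : ℝ) = 4 * √α := by
    simp only [Fintype.card_prod, Fintype.card_fin, Nat.cast_mul]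
    field_simp
    nlinarith
  rw [hR, adjacencyOracle_mk]
  by_cases h : (permGraph π).Adj u v
  · have := card_filter_permGraph_adj_ne_le π a b ha hb u v
    have : ((Finset.univ.filter fun r : Fin α × Fin α => ¬ ((permGraph π).Adj u v ↔
      (permGraph (π * Equiv.swap (a r.1) (b r.2))).Adj u v)).card : ℝ) ≤ 4 * α := by
      exact_mod_cast this
    simp only [h, decide_true, bitWeight, if_true] at this ⊢
    rw [inv_mul_le_iff₀ hs]
    nlinarith
  · have := card_filter_permGraph_adj_ne_le_four π a b ha hb u v h
    have : ((Finset.univ.filter fun r : Fin α × Fin α => ¬ ((permGraph π).Adj u v ↔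
      (permGraph (π * Equiv.swap (a r.1) (b r.2))).Adj u v)).card : ℝ) ≤ 4 := by
      exact_mod_cast this
    simp only [h, decide_false, bitWeight] at this ⊢
    simp only [Bool.false_eq_true, if_false]
    nlinarith

/-- The graph with the edges `a t, b t` for `t ∈ T`. -/
def pairsGraph {k : ℕ} (a b : Fin k → V) (T : Set (Fin k)) : SimpleGraph V :=
  SimpleGraph.fromEdgeSet ((fun t => s(a t, b t)) '' T)

theorem pairsGraph_adj {k : ℕ} {a b : Fin k → V} {T : Set (Fin k)} {u v : V} :
    (pairsGraph a b T).Adj u v ↔ (∃ t ∈ T, s(a t, b t) = s(u, v)) ∧ u ≠ v := by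
  simp only [pairsGraph, SimpleGraph.fromEdgeSet_adj, Set.mem_image]

theorem pairsGraph_adj_compl_singleton {k : ℕ} {a b : Fin k → V} {t : Fin k} {u v : V}
    (h : ¬ ((pairsGraph a b {t}ᶜ).Adj u v ↔ (pairsGraph a b Set.univ).Adj u v)) :
    ¬ (pairsGraph a b {t}ᶜ).Adj u v ∧ (pairsGraph a b Set.univ).Adj u v ∧
      s(a t, b t) = s(u, v) := by
  have hle : (pairsGraph a b {t}ᶜ).Adj u v → (pairsGraph a b Set.univ).Adj u v := by
    rw [pairsGraph_adj, pairsGraph_adj]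
    rintro ⟨⟨r, -, hr⟩, hne⟩
    exact ⟨⟨r, trivial, hr⟩, hne⟩
  have h1 : ¬ (pairsGraph a b {t}ᶜ).Adj u v := fun h' => h ⟨hle, fun _ => h'⟩
  have h2 : (pairsGraph a b Set.univ).Adj u v := by tauto
  refine ⟨h1, h2, ?_⟩
  obtain ⟨⟨r, -, hr⟩, hne⟩ := pairsGraph_adj.1 h2
  by_cases hrt : r = t
  · rwa [← hrt]
  · exact absurd (pairsGraph_adj.2 ⟨⟨r, hrt, hr⟩, hne⟩) h1

variable [Fintype V] [DecidableEq V]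

theorem DecidesWithBoundedError.outputProb_true {A : Algorithm (VertexPair V)}
    {P : SimpleGraph V → Prop} (hA : DecidesWithBoundedError A P) {G : SimpleGraph V} (h : P G) :
    2 / 3 ≤ A.outputProb (adjacencyOracle G) true := by
  simpa [h] using hA G

theorem DecidesWithBoundedError.outputProb_false {A : Algorithm (VertexPair V)}
    {P : SimpleGraph V → Prop} (hA : DecidesWithBoundedError A P) {G : SimpleGraph V} (h : ¬ P G) :
    2 / 3 ≤ A.outputProb (adjacencyOracle G) false := by
  simpa [h] using hA G

/-- A query lower bound from a permutation `c` whose cycle structure can be changed by composing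
with any of `α ^ 2` transpositions, each of which can be moved to `α ^ 2` places by permutations
that commute with the result. -/
theorem sqrt_mul_le_queries_of_permGraph {A : Algorithm (VertexPair V)} {P : SimpleGraph V → Prop}
    (hA : DecidesWithBoundedError A P) {α : ℕ} (hα : 0 < α) (c : Equiv.Perm V) (i j : Fin α → V)
    (hi : i.Injective) (hj : j.Injective) (ρ : Fin α × Fin α → Fin α × Fin α → Equiv.Perm V)
    (hρ : ∀ l r, Commute (ρ l r) (c * Equiv.swap (i l.1) (j l.2)))
    (a b : Fin α × Fin α → Fin α → V) (ha : ∀ l, (a l).Injective) (hb : ∀ l, (b l).Injective)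
    (hρi : ∀ l r, ρ l r (i l.1) = a l r.1) (hρj : ∀ l r, ρ l r (j l.2) = b l r.2)
    (hno : ∀ (σ : Equiv.Perm V) (l : Fin α × Fin α),
      ¬ P (permGraph (σ * (c * Equiv.swap (i l.1) (j l.2)) * σ⁻¹)))
    (hyes : ∀ σ : Equiv.Perm V, P (permGraph (σ * c * σ⁻¹))) :
    α * √α / 144 ≤ (A.queries : ℝ) := by
  have hα' : (0 : ℝ) < α := by exact_mod_cast hα
  have hs : 0 < √(α : ℝ) := Real.sqrt_pos.2 hα'
  have : Nonempty (Fin α) := ⟨⟨0, hα⟩⟩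
  have key := A.symmetrized_adversary_bound (H := Equiv.Perm V)
    (fun σ l => adjacencyOracle (permGraph (σ * (c * Equiv.swap (i l.1) (j l.2)) * σ⁻¹)))
    (fun σ => adjacencyOracle (permGraph (σ * c * σ⁻¹))) ρ (√α) (4 / (α * √α)) hs (by positivity)
    (fun σ l => hA.outputProb_false (hno σ l)) (fun σ => hA.outputProb_true (hyes σ)) ?_ ?_ ?_
  · refine le_trans (le_of_eq ?_) key
    field_simp
    norm_num
  · intro σ l r
    have : σ * ρ l r * (c * Equiv.swap (i l.1) (j l.2)) * (σ * ρ l r)⁻¹ =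
        σ * (c * Equiv.swap (i l.1) (j l.2)) * σ⁻¹ := by
      rw [mul_assoc σ, (hρ l r).eq]; group
    simp only [this]
  · intro σ l e
    have h := bitWeight_mul_card_permGraph_le hα (σ * (c * Equiv.swap (i l.1) (j l.2)) * σ⁻¹)
      (σ ∘ a l) (σ ∘ b l) (σ.injective.comp (ha l)) (σ.injective.comp (hb l)) e
    -- Undoing the swap recovers `c`. Conjugation by `ρ l r` fixes the swapped permutation but moves
    -- the undoing swap to the points `a l r.1`, `b l r.2`.
    have heq : ∀ r : Fin α × Fin α, σ * ρ l r * c * (σ * ρ l r)⁻¹ =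
        σ * (c * Equiv.swap (i l.1) (j l.2)) * σ⁻¹ *
          Equiv.swap ((σ ∘ a l) r.1) ((σ ∘ b l) r.2) := by
      intro r
      have h1 : Equiv.swap ((σ ∘ a l) r.1) ((σ ∘ b l) r.2) =
          (σ * ρ l r) * Equiv.swap (i l.1) (j l.2) * (σ * ρ l r)⁻¹ := by
        rw [← Equiv.swap_apply_apply]
        simp [hρi, hρj]
      have h2 : σ * (c * Equiv.swap (i l.1) (j l.2)) * σ⁻¹ =
          σ * ρ l r * (c * Equiv.swap (i l.1) (j l.2)) * (σ * ρ l r)⁻¹ := by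
        rw [mul_assoc σ (ρ l r), (hρ l r).eq]; group
      have h3 : c = c * Equiv.swap (i l.1) (j l.2) * Equiv.swap (i l.1) (j l.2) := by
        rw [mul_assoc, Equiv.swap_mul_self, mul_one]
      rw [h1, h2]
      conv_lhs => rw [h3]
      group
    simp only [heq]
    exact h
  · intro σ e
    have h := bitWeight_mul_card_permGraph_le hα (σ * c * σ⁻¹)
      (σ ∘ i) (σ ∘ j) (σ.injective.comp hi) (σ.injective.comp hj) e
    have heq : ∀ l : Fin α × Fin α, σ * (c * Equiv.swap (i l.1) (j l.2)) * σ⁻¹ =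
        σ * c * σ⁻¹ * Equiv.swap ((σ ∘ i) l.1) ((σ ∘ j) l.2) := by
      intro l
      rw [Function.comp_apply, Function.comp_apply, Equiv.swap_apply_apply]
      group
    simp only [heq]
    exact h

/-- Distinguishing `k` disjoint edges from `k - 1` disjoint edges is as hard as an unstructured
search for one of `k` edges among the `m ^ 2` places allowed by `2 * m` isolated vertices. -/
theorem sqrt_mul_le_queries_of_pairsGraph {k m : ℕ} {A : Algorithm (VertexPair V)}
    (hA : DecidesWithBoundedError A (fun G => HasMatchingOfSize G k)) (hk : 0 < k) (hm : 0 < m)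
    (a b : Fin k → V) (a' b' : Fin m → V)
    (hinj : Function.Injective (Sum.elim (Sum.elim a b) (Sum.elim a' b'))) :
    m * √k / 36 ≤ (A.queries : ℝ) := by
  classical
  have hk' : (0 : ℝ) < k := by exact_mod_cast hk
  have hm' : (0 : ℝ) < m := by exact_mod_cast hm
  have hs : 0 < √(k : ℝ) := Real.sqrt_pos.2 hk'
  have hsq : √(k : ℝ) * √(k : ℝ) = k := Real.mul_self_sqrt hk'.le
  have : Nonempty (Fin k) := ⟨⟨0, hk⟩⟩
  have : Nonempty (Fin m) := ⟨⟨0, hm⟩⟩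
  have ha : a.Injective := fun s t e => by
    simpa using @hinj (Sum.inl (Sum.inl s)) (Sum.inl (Sum.inl t)) e
  have hb : b.Injective := fun s t e => by
    simpa using @hinj (Sum.inl (Sum.inr s)) (Sum.inl (Sum.inr t)) e
  have ha' : a'.Injective := fun s t e => by
    simpa using @hinj (Sum.inr (Sum.inl s)) (Sum.inr (Sum.inl t)) e
  have hb' : b'.Injective := fun s t e => by
    simpa using @hinj (Sum.inr (Sum.inr s)) (Sum.inr (Sum.inr t)) e
  have hab : ∀ s t, a s ≠ b t := fun s t e => by
    simpa using @hinj (Sum.inl (Sum.inl s)) (Sum.inl (Sum.inr t)) e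
  have hab' : ∀ s t, a' s ≠ b' t := fun s t e => by
    simpa using @hinj (Sum.inr (Sum.inl s)) (Sum.inr (Sum.inr t)) e
  have haa' : ∀ s t, a s ≠ a' t := fun s t e => by
    simpa using @hinj (Sum.inl (Sum.inl s)) (Sum.inr (Sum.inl t)) e
  have hab'' : ∀ s t, a s ≠ b' t := fun s t e => by
    simpa using @hinj (Sum.inl (Sum.inl s)) (Sum.inr (Sum.inr t)) e
  have hba' : ∀ s t, b s ≠ a' t := fun s t e => by
    simpa using @hinj (Sum.inl (Sum.inr s)) (Sum.inr (Sum.inl t)) e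
  have hbb' : ∀ s t, b s ≠ b' t := fun s t e => by
    simpa using @hinj (Sum.inl (Sum.inr s)) (Sum.inr (Sum.inr t)) e
  -- Moves the removed pair `t` onto spare vertices and fixes every other pair, so the graph without
  -- pair `t` is unchanged.
  set ρ : Fin k → Fin m × Fin m → Equiv.Perm V := fun t r =>
    Equiv.swap (a t) (a' r.1) * Equiv.swap (b t) (b' r.2) with hρ
  have hρa : ∀ t r, ρ t r (a t) = a' r.1 := fun t r => by
    rw [hρ, Equiv.Perm.mul_apply, Equiv.swap_apply_of_ne_of_ne (hab _ _) (hab'' _ _),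
      Equiv.swap_apply_left]
  have hρb : ∀ t r, ρ t r (b t) = b' r.2 := fun t r => by
    rw [hρ, Equiv.Perm.mul_apply, Equiv.swap_apply_left,
      Equiv.swap_apply_of_ne_of_ne (hab'' _ _).symm (hab' _ _).symm]
  have hρa_ne : ∀ t r u, u ≠ t → ρ t r (a u) = a u := fun t r u hu => by
    rw [hρ, Equiv.Perm.mul_apply, Equiv.swap_apply_of_ne_of_ne (hab _ _) (hab'' _ _),
      Equiv.swap_apply_of_ne_of_ne (fun e => hu (ha e)) (haa' _ _)]
  have hρb_ne : ∀ t r u, u ≠ t → ρ t r (b u) = b u := fun t r u hu => by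
    rw [hρ, Equiv.Perm.mul_apply,
      Equiv.swap_apply_of_ne_of_ne (fun e => hu (hb e)) (hbb' _ _),
      Equiv.swap_apply_of_ne_of_ne (hab _ _).symm (hba' _ _)]
  have hinv : ∀ (σ : Equiv.Perm V) t r,
      pairsGraph (⇑(σ * ρ t r) ∘ a) (⇑(σ * ρ t r) ∘ b) {t}ᶜ =
        pairsGraph (σ ∘ a) (σ ∘ b) {t}ᶜ := by
    intro σ t r
    rw [pairsGraph, pairsGraph]
    congr 1
    refine Set.image_congr fun u hu => ?_
    simp [hρa_ne t r u hu, hρb_ne t r u hu]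
  -- A given non-edge is the added one for at most one of `m ^ 2` choices, and a given edge the
  -- removed one for at most one of `k`. The conditions `s ≤ ε * m ^ 2` and `s⁻¹ ≤ ε * k` are both
  -- equalities at `s = m / √k`, `ε = 1 / (m * √k)`.
  have key := A.symmetrized_adversary_bound (H := Equiv.Perm V) (Λ := Fin k) (R := Fin m × Fin m)
    (fun σ t => adjacencyOracle (pairsGraph (σ ∘ a) (σ ∘ b) {t}ᶜ))
    (fun σ => adjacencyOracle (pairsGraph (σ ∘ a) (σ ∘ b) Set.univ)) ρ (m / √k) (1 / (m * √k))
    (by positivity) (by positivity)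
    (fun σ t => hA.outputProb_false ?_) (fun σ => hA.outputProb_true ?_) ?_ ?_ ?_
  · refine le_trans (le_of_eq ?_) key
    field_simp
  · apply not_hasMatchingOfSize_of_ncard_edgeSet_lt
    rw [pairsGraph]
    calc _ ≤ ((fun u => s((σ ∘ a) u, (σ ∘ b) u)) '' {t}ᶜ).ncard := by
          refine Set.ncard_le_ncard ?_ (Set.toFinite _)
          rw [SimpleGraph.edgeSet_fromEdgeSet]
          exact Set.sdiff_subset
      _ ≤ ({t}ᶜ : Set (Fin k)).ncard := Set.ncard_image_le (Set.toFinite _)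
      _ < k := by
          rw [Set.ncard_compl, Set.ncard_singleton, Nat.card_fin]; omega
  · refine hasMatchingOfSize_of_adj (σ ∘ a) (σ ∘ b) ?_ fun t => ?_
    · rw [← Sum.comp_elim]
      exact σ.injective.comp fun s t e => Sum.inl_injective (hinj e)
    · exact pairsGraph_adj.2 ⟨⟨t, trivial, rfl⟩, fun e => hab _ _ (σ.injective e)⟩
  · intro σ t r
    simp only [hinv]
  · rintro σ t ⟨e, he⟩
    induction e using Sym2.ind with | _ u v => ?_
    simp only [adjacencyOracle_mk_ne_iff]
    rw [adjacencyOracle_mk]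
    have hR : 1 / (m * √k) * (Fintype.card (Fin m × Fin m) : ℝ) = m / √k := by
      simp only [Fintype.card_prod, Fintype.card_fin, Nat.cast_mul]; field_simp
    rw [hR]
    have hdiff : ∀ r, ¬ ((pairsGraph (σ ∘ a) (σ ∘ b) {t}ᶜ).Adj u v ↔
        (pairsGraph (⇑(σ * ρ t r) ∘ a) (⇑(σ * ρ t r) ∘ b) Set.univ).Adj u v) →
        ¬ (pairsGraph (σ ∘ a) (σ ∘ b) {t}ᶜ).Adj u v ∧
          s(σ (a' r.1), σ (b' r.2)) = s(u, v) := by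
      intro r hr
      rw [← hinv σ t r] at hr ⊢
      obtain ⟨h1, -, h2⟩ := pairsGraph_adj_compl_singleton hr
      exact ⟨h1, by simpa [hρa, hρb] using h2⟩
    by_cases h : (pairsGraph (σ ∘ a) (σ ∘ b) {t}ᶜ).Adj u v
    · rw [Finset.filter_false_of_mem]
      · simp only [Finset.card_empty, Nat.cast_zero, mul_zero]; positivity
      · exact fun r _ hr => (hdiff r hr).1 h
    · have hcard : (Finset.univ.filter fun r : Fin m × Fin m =>
          ¬ ((pairsGraph (σ ∘ a) (σ ∘ b) {t}ᶜ).Adj u v ↔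
            (pairsGraph (⇑(σ * ρ t r) ∘ a) (⇑(σ * ρ t r) ∘ b) Set.univ).Adj u v)).card ≤ 1 := by
        refine Finset.card_le_one.2 ?_
        simp only [Finset.mem_filter, Finset.mem_univ, true_and]
        intro r hr r' hr'
        rcases Sym2.eq_iff.1 ((hdiff r hr).2.trans (hdiff r' hr').2.symm) with e | e
        · exact Prod.ext (ha' (σ.injective e.1)) (hb' (σ.injective e.2))
        · exact absurd (σ.injective e.1) (hab' _ _)
      simp only [h, decide_false, bitWeight, Bool.false_eq_true, if_false] at hcard ⊢
      exact mul_le_of_le_one_right (by positivity) (by exact_mod_cast hcard)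
  · rintro σ ⟨e, he⟩
    induction e using Sym2.ind with | _ u v => ?_
    simp only [adjacencyOracle_mk_ne_iff]
    rw [adjacencyOracle_mk]
    have hR : 1 / (m * √k) * (Fintype.card (Fin k) : ℝ) = (m / √k)⁻¹ := by
      rw [Fintype.card_fin]; field_simp; nlinarith
    rw [hR]
    by_cases h : (pairsGraph (σ ∘ a) (σ ∘ b) Set.univ).Adj u v
    · have hcard : (Finset.univ.filter fun t : Fin k =>
          ¬ ((pairsGraph (σ ∘ a) (σ ∘ b) Set.univ).Adj u v ↔
            (pairsGraph (σ ∘ a) (σ ∘ b) {t}ᶜ).Adj u v)).card ≤ 1 := by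
        refine Finset.card_le_one.2 ?_
        simp only [Finset.mem_filter, Finset.mem_univ, true_and]
        intro t ht t' ht'
        have e := (pairsGraph_adj_compl_singleton fun h => ht h.symm).2.2.trans
          (pairsGraph_adj_compl_singleton fun h => ht' h.symm).2.2.symm
        rcases Sym2.eq_iff.1 e with e | e
        · exact ha (σ.injective e.1)
        · exact absurd (σ.injective e.1) (hab _ _)
      simp only [h, decide_true, bitWeight, if_true] at hcard ⊢
      exact mul_le_of_le_one_right (by positivity) (by exact_mod_cast hcard)
    · rw [Finset.filter_false_of_mem]
      · simp only [Finset.card_empty, Nat.cast_zero, mul_zero]; positivity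
      · intro t _ ht
        exact h (pairsGraph_adj_compl_singleton fun h => ht h.symm).2.1

end Families

/-! ### Splitting a cycle in two and rotating the pieces -/

theorem exists_perm_commute_piecewise {V : Type} [Finite V] (τ : Equiv.Perm V) (S : Set V)
    (hS : ∀ v, τ v ∈ S ↔ v ∈ S) (p q : ℕ) :
    ∃ ρ : Equiv.Perm V, Commute ρ τ ∧ (∀ v ∈ S, ρ v = (τ ^ p) v) ∧
      ∀ v ∉ S, ρ v = (τ ^ q) v := by
  classical
  have hpow : ∀ (m : ℕ) v, (τ ^ m) v ∈ S ↔ v ∈ S := by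
    intro m
    induction m with
    | zero => simp
    | succ m ih => intro v; rw [pow_succ', Equiv.Perm.mul_apply, hS, ih]
  have hinj : Function.Injective fun v => if v ∈ S then (τ ^ p) v else (τ ^ q) v := by
    intro u v h
    by_cases hu : u ∈ S <;> by_cases hv : v ∈ S <;> simp only [hu, hv, if_true, if_false] at h
    · exact (τ ^ p).injective h
    · exact absurd ((hpow q v).1 (h ▸ (hpow p u).2 hu)) hv
    · exact absurd ((hpow q u).1 (h ▸ (hpow p v).2 hv)) hu
    · exact (τ ^ q).injective h
  refine ⟨Equiv.ofBijective _ (Finite.injective_iff_bijective.1 hinj), ?_, fun v hv => if_pos hv,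
    fun v hv => if_neg hv⟩
  ext v
  rw [Equiv.Perm.mul_apply, Equiv.Perm.mul_apply, Equiv.ofBijective_apply, Equiv.ofBijective_apply]
  simp only [hS]
  split_ifs
  · rw [← Equiv.Perm.mul_apply, ← Equiv.Perm.mul_apply, (Commute.self_pow τ p).eq]
  · rw [← Equiv.Perm.mul_apply, ← Equiv.Perm.mul_apply, (Commute.self_pow τ q).eq]

theorem exists_perm_cycle {n N : ℕ} (hN : 0 < N) (hn : N ≤ n) :
    ∃ c : Equiv.Perm (Fin n), ∀ v, (c v : ℕ) =
      if (v : ℕ) + 1 < N then (v : ℕ) + 1 else if (v : ℕ) + 1 = N then 0 else v := by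
  refine ⟨Fin.cycleRange ⟨N - 1, by omega⟩, fun v => ?_⟩
  rcases lt_trichotomy v ⟨N - 1, by omega⟩ with h | h | h
  · rw [Fin.coe_cycleRange_of_lt h, if_pos]
    rw [Fin.lt_def] at h; simp only at h; omega
  · subst h
    rw [Fin.coe_cycleRange_of_le le_rfl, if_pos rfl, if_neg (by simp only; omega),
      if_pos (by simp only; omega)]
  · rw [Fin.cycleRange_of_gt h]
    rw [Fin.lt_def] at h; simp only at h
    rw [if_neg (by omega), if_neg (by omega)]

/-- The swap exchanges the successors of `i` and `j`, so the cycle breaks into the arc `Ioc i j` and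
the rest. -/
theorem val_mul_swap_cycle {n N : ℕ} {c : Equiv.Perm (Fin n)} (hc : ∀ v, (c v : ℕ) =
      if (v : ℕ) + 1 < N then (v : ℕ) + 1 else if (v : ℕ) + 1 = N then 0 else v)
    {i j : Fin n} (hij : (i : ℕ) < j) (hj : (j : ℕ) + 1 < N) (v : Fin n) :
    ((c * Equiv.swap i j) v : ℕ) =
      if (v : ℕ) = i then (j : ℕ) + 1 else if (v : ℕ) = j then (i : ℕ) + 1 else
      if (v : ℕ) + 1 < N then (v : ℕ) + 1 else if (v : ℕ) + 1 = N then 0 else v := by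
  rw [Equiv.Perm.mul_apply, Equiv.swap_apply_def]
  by_cases h1 : v = i
  · subst h1
    rw [if_pos rfl, if_pos rfl, hc, if_pos hj]
  · have h1' : (v : ℕ) ≠ i := fun h => h1 (Fin.ext h)
    rw [if_neg h1, if_neg h1']
    by_cases h2 : v = j
    · subst h2
      rw [if_pos rfl, if_pos rfl, hc, if_pos (by omega)]
    · have h2' : (v : ℕ) ≠ j := fun h => h2 (Fin.ext h)
      rw [if_neg h2, if_neg h2', hc]

/-- The orbit of `i` jumps over the arc to `j + 1` and then advances by one; `hm` stops it before it
wraps to 0. -/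
theorem val_pow_mul_swap_cycle_left {n N : ℕ} {c : Equiv.Perm (Fin n)} (hc : ∀ v, (c v : ℕ) =
      if (v : ℕ) + 1 < N then (v : ℕ) + 1 else if (v : ℕ) + 1 = N then 0 else v)
    {i j : Fin n} (hij : (i : ℕ) < j) (m : ℕ) (hm : (j : ℕ) + m + 1 < N) :
    (((c * Equiv.swap i j) ^ (m + 1)) i : ℕ) = j + m + 1 := by
  induction m with
  | zero => rw [zero_add, pow_one, val_mul_swap_cycle hc hij (by omega), if_pos rfl, add_zero]
  | succ m ih =>
    rw [pow_succ', Equiv.Perm.mul_apply, val_mul_swap_cycle hc hij (by omega), ih (by omega)]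
    split_ifs <;> omega

theorem val_pow_mul_swap_cycle_right {n N : ℕ} {c : Equiv.Perm (Fin n)} (hc : ∀ v, (c v : ℕ) =
      if (v : ℕ) + 1 < N then (v : ℕ) + 1 else if (v : ℕ) + 1 = N then 0 else v)
    {i j : Fin n} (hij : (i : ℕ) < j) (hj : (j : ℕ) + 1 < N) (m : ℕ) (hm : (i : ℕ) + m + 1 ≤ j) :
    (((c * Equiv.swap i j) ^ (m + 1)) j : ℕ) = i + m + 1 := by
  induction m with
  | zero =>
    rw [zero_add, pow_one, val_mul_swap_cycle hc hij hj, if_neg (by omega), if_pos rfl, add_zero]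
  | succ m ih =>
    rw [pow_succ', Equiv.Perm.mul_apply, val_mul_swap_cycle hc hij hj, ih (by omega)]
    split_ifs <;> omega

theorem mul_swap_cycle_mem_iff {n N : ℕ} {c : Equiv.Perm (Fin n)} (hc : ∀ v, (c v : ℕ) =
      if (v : ℕ) + 1 < N then (v : ℕ) + 1 else if (v : ℕ) + 1 = N then 0 else v)
    {i j : Fin n} (hij : (i : ℕ) < j) (hj : (j : ℕ) + 1 < N) (v : Fin n) :
    (c * Equiv.swap i j) v ∈ Finset.Ioc i j ↔ v ∈ Finset.Ioc i j := by
  rw [Finset.mem_Ioc, Finset.mem_Ioc, Fin.lt_def, Fin.lt_def, Fin.le_def, Fin.le_def,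
    val_mul_swap_cycle hc hij hj]
  split_ifs <;> omega

theorem not_hasMatchingOfSize_mul_swap_cycle {n k : ℕ} {c : Equiv.Perm (Fin n)}
    (hc : ∀ v, (c v : ℕ) = if (v : ℕ) + 1 < 2 * k then (v : ℕ) + 1 else
      if (v : ℕ) + 1 = 2 * k then 0 else v)
    {i j : Fin n} (hij : (i : ℕ) < j) (hj : (j : ℕ) + 1 < 2 * k) (hodd : Odd ((j : ℕ) - i))
    (σ : Equiv.Perm (Fin n)) :
    ¬ HasMatchingOfSize (permGraph (σ * (c * Equiv.swap i j) * σ⁻¹)) k := by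
  have hadj : ∀ u v, (permGraph (σ * (c * Equiv.swap i j) * σ⁻¹)).Adj u v →
      σ⁻¹ u ≠ σ⁻¹ v ∧ ((c * Equiv.swap i j) (σ⁻¹ u) = σ⁻¹ v ∨
        (c * Equiv.swap i j) (σ⁻¹ v) = σ⁻¹ u) := by
    intro u v h
    obtain ⟨hne, h⟩ := permGraph_adj.1 h
    refine ⟨fun e => hne (σ⁻¹.injective e), h.imp (fun e => ?_) (fun e => ?_)⟩ <;>
    · rw [← e, mul_assoc]
      simp
  refine not_hasMatchingOfSize_of_odd
    ((Finset.univ.filter fun v : Fin n => (v : ℕ) < 2 * k).map σ.toEmbedding)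
    ((Finset.Ioc i j).map σ.toEmbedding) ?_ ?_ ?_ ?_ ?_
  · rw [Finset.card_map]
    calc _ ≤ (Finset.range (2 * k)).card := Finset.card_le_card_of_injOn Fin.val
          (fun v hv => by simpa using hv) Fin.val_injective.injOn
      _ = _ := Finset.card_range _
  · intro u v h
    obtain ⟨hne, h⟩ := hadj u v h
    have hne' : (σ⁻¹ u : ℕ) ≠ (σ⁻¹ v : Fin n) := fun e => hne (Fin.ext e)
    rw [Finset.mem_map_equiv, Finset.mem_filter]
    refine ⟨Finset.mem_univ _, ?_⟩
    change ((σ⁻¹ u : Fin n) : ℕ) < 2 * k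
    by_contra hlt
    -- Points from `2 * k` on are fixed and hence isolated.
    rcases h with h | h <;>
    · have := congrArg Fin.val h
      rw [val_mul_swap_cycle hc hij hj] at this
      split_ifs at this <;> omega
  · refine Finset.map_subset_map.2 fun v hv => ?_
    have := Fin.le_def.1 (Finset.mem_Ioc.1 hv).2
    exact Finset.mem_filter.2 ⟨Finset.mem_univ _, by omega⟩
  · rwa [Finset.card_map, Fin.card_Ioc]
  · intro u v h hu
    obtain ⟨-, h⟩ := hadj u v h
    rw [Finset.mem_map_equiv] at hu ⊢
    change σ⁻¹ u ∈ _ at hu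
    change σ⁻¹ v ∈ _
    rcases h with h | h
    · rw [← h]; exact (mul_swap_cycle_mem_iff hc hij hj _).2 hu
    · rw [← h] at hu; exact (mul_swap_cycle_mem_iff hc hij hj _).1 hu

theorem hasMatchingOfSize_cycle {n k : ℕ} (hn : 2 * k ≤ n) {c : Equiv.Perm (Fin n)}
    (hc : ∀ v, (c v : ℕ) = if (v : ℕ) + 1 < 2 * k then (v : ℕ) + 1 else
      if (v : ℕ) + 1 = 2 * k then 0 else v) (σ : Equiv.Perm (Fin n)) :
    HasMatchingOfSize (permGraph (σ * c * σ⁻¹)) k := by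
  refine hasMatchingOfSize_of_adj (fun t : Fin k => σ ⟨2 * t, by omega⟩)
    (fun t => σ ⟨2 * t + 1, by omega⟩) ?_ fun t => ?_
  · rintro (s | s) (t | t) h <;> simp at h ⊢ <;> omega
  · rw [permGraph_adj]
    refine ⟨fun h => by simp at h, Or.inl ?_⟩
    rw [Equiv.Perm.mul_apply, Equiv.Perm.mul_apply, Equiv.Perm.inv_def, Equiv.symm_apply_apply]
    congr 1
    ext
    rw [hc, if_pos (by simp only; omega)]

theorem sqrt_mul_le_queries_of_cycles {n k α : ℕ} (hα : 0 < α) (hαk : 4 * α ≤ k) (hn : 2 * k ≤ n)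
    {A : Algorithm (VertexPair (Fin n))}
    (hA : DecidesWithBoundedError A (fun G => HasMatchingOfSize G k)) :
    α * √α / 144 ≤ (A.queries : ℝ) := by
  obtain ⟨c, hc⟩ := exists_perm_cycle (N := 2 * k) (by omega) hn
  -- Even `i` and odd `j` make the arc odd. The gap between `2 * α` and `4 * α`, and `8 * α ≤ 2 *
  -- k`, leave room for `α` rotation steps on both cycles without wrapping.
  set i : Fin α → Fin n := fun a => ⟨2 * a, by omega⟩ with hi
  set j : Fin α → Fin n := fun b => ⟨4 * α + 2 * b + 1, by omega⟩ with hj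
  have hij : ∀ l : Fin α × Fin α, (i l.1 : ℕ) < j l.2 := fun l => by simp only [hi, hj]; omega
  have hjk : ∀ b, (j b : ℕ) + 1 < 2 * k := fun b => by simp only [hj]; omega
  have hρ : ∀ l r : Fin α × Fin α, ∃ ρ : Equiv.Perm (Fin n),
      Commute ρ (c * Equiv.swap (i l.1) (j l.2)) ∧
      ρ (i l.1) = ⟨4 * α + 2 * l.2 + 1 + r.1 + 1, by omega⟩ ∧
      ρ (j l.2) = ⟨2 * l.1 + r.2 + 1, by omega⟩ := by
    intro l r
    -- `j` lies on the arc and is rotated `r.2 + 1` times; `i` lies off it and is rotated `r.1 + 1`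
    -- times.
    obtain ⟨ρ, h1, h2, h3⟩ := exists_perm_commute_piecewise (c * Equiv.swap (i l.1) (j l.2))
      (Finset.Ioc (i l.1) (j l.2) : Finset (Fin n))
      (mul_swap_cycle_mem_iff hc (hij l) (hjk l.2)) (r.2 + 1) (r.1 + 1)
    refine ⟨ρ, h1, ?_, ?_⟩
    · rw [h3 _ (by simp)]
      ext
      rw [val_pow_mul_swap_cycle_left hc (hij l) _ (by simp only [hj]; omega)]
    · rw [h2 _ (by simp [Fin.lt_def, hij l])]
      ext
      rw [val_pow_mul_swap_cycle_right hc (hij l) (hjk _) _ (by simp only [hi, hj]; omega)]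
  choose ρ hρ₁ hρ₂ hρ₃ using hρ
  refine sqrt_mul_le_queries_of_permGraph hA hα c i j ?_ ?_ ρ hρ₁
    (fun l p => ⟨4 * α + 2 * l.2 + 1 + p + 1, by omega⟩) (fun l q => ⟨2 * l.1 + q + 1, by omega⟩)
    ?_ ?_ hρ₂ hρ₃ (fun σ l => not_hasMatchingOfSize_mul_swap_cycle hc (hij l) (hjk l.2) ?_ σ)
    (hasMatchingOfSize_cycle hn hc)
  · intro s t h; simp [hi] at h; omega
  · intro s t h; simp [hj] at h; omega
  · intro l s t h; simp at h; omega
  · intro l s t h; simp at h; omega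
  · refine ⟨2 * α + l.2 - l.1, ?_⟩
    simp only [hi, hj]; omega

/-- The empty and the complete graph as a single pair with `s = ε = 1` give at least 1/36, hence at
least one query. Needed for `k ≤ 3`, where `k / 4 = 0`. -/
theorem queries_pos_of_decides_hasMatchingOfSize {n k : ℕ} (hk : 0 < k) (hn : 2 * k ≤ n)
    {A : Algorithm (VertexPair (Fin n))}
    (hA : DecidesWithBoundedError A (fun G => HasMatchingOfSize G k)) :
    (1 : ℝ) ≤ A.queries := by
  have hno : ¬ HasMatchingOfSize (⊥ : SimpleGraph (Fin n)) k :=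
    not_hasMatchingOfSize_of_ncard_edgeSet_lt (by simpa using hk)
  have hyes : HasMatchingOfSize (⊤ : SimpleGraph (Fin n)) k := by
    refine hasMatchingOfSize_of_adj (fun t : Fin k => ⟨2 * t, by omega⟩)
      (fun t => ⟨2 * t + 1, by omega⟩) ?_ fun t => by simp
    rintro (s | s) (t | t) h <;> simp at h ⊢ <;> omega
  have h := A.adversary_bound (Ω := Unit) (fun _ => adjacencyOracle ⊥) (fun _ => adjacencyOracle ⊤)
    1 1 one_pos one_pos (fun _ => hA.outputProb_false hno) (fun _ => hA.outputProb_true hyes)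
    ?_ ?_
  · have : (0 : ℝ) < A.queries := lt_of_lt_of_le (by norm_num) h
    exact_mod_cast this
  all_goals
    intro f hf
    simp only [bitWeight, inv_one, ite_self, one_mul]
    refine Finset.sum_le_sum fun _ _ => Finset.sum_le_sum fun i _ => ?_
    split_ifs
    · exact le_rfl
    · exact hf _ _

end QuantumQuery

/-! ### Combining the ranges of `k` -/

theorem theorem6 :
    ∃ c : ℝ, 0 < c ∧ ∀ n k : ℕ, (k : ℝ) ≤ (n : ℝ) / 2 →
      ∀ A : QuantumQuery.Algorithm (QuantumQuery.VertexPair (Fin n)),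
        QuantumQuery.DecidesWithBoundedError A
            (fun G => QuantumQuery.HasMatchingOfSize G k) →
          c * (Real.sqrt k * n) ≤ (A.queries : ℝ) := by
  -- The worst case is the cycle family, which needs `3 * 28 * 144 = 12096`; the others need `7 *
  -- 36` and `2 * 12`.
  refine ⟨1 / 20000, by norm_num, fun n k hkn A hA => ?_⟩
  have hn : 2 * k ≤ n := by
    have : (2 * k : ℝ) ≤ n := by linarith
    exact_mod_cast this
  rcases Nat.eq_zero_or_pos k with rfl | hk
  · simp
  have hsk : 0 ≤ √(k : ℝ) := Real.sqrt_nonneg _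
  by_cases h4 : 4 * k ≤ n
  · obtain ⟨e⟩ := Function.Embedding.nonempty_of_card_le
      (α := (Fin k ⊕ Fin k) ⊕ (Fin (n / 4) ⊕ Fin (n / 4))) (β := Fin n)
      (by simp only [Fintype.card_sum, Fintype.card_fin]; omega)
    have h := QuantumQuery.sqrt_mul_le_queries_of_pairsGraph hA hk (by omega : 0 < n / 4)
      (fun t => e (Sum.inl (Sum.inl t))) (fun t => e (Sum.inl (Sum.inr t)))
      (fun t => e (Sum.inr (Sum.inl t))) (fun t => e (Sum.inr (Sum.inr t)))
      (by convert e.injective using 1; ext x; rcases x with (x | x) | (x | x) <;> rfl)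
    have hm : (n : ℝ) ≤ 7 * (n / 4 : ℕ) := by
      have : n ≤ 7 * (n / 4) := by omega
      exact_mod_cast this
    have h0 : (0 : ℝ) ≤ (n / 4 : ℕ) := Nat.cast_nonneg _
    have := mul_le_mul_of_nonneg_left hm hsk
    have := mul_nonneg h0 hsk
    linarith
  by_cases hk3 : k ≤ 3
  · have h := QuantumQuery.queries_pos_of_decides_hasMatchingOfSize hk hn hA
    have h1 : √(k : ℝ) ≤ 2 := by
      rw [Real.sqrt_le_left (by norm_num)]
      have : (k : ℝ) ≤ 3 := by exact_mod_cast hk3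
      linarith
    have h2 : (n : ℝ) ≤ 12 := by
      have : n ≤ 12 := by omega
      exact_mod_cast this
    have := mul_le_mul h1 h2 (Nat.cast_nonneg _) (by norm_num)
    linarith
  -- Here `n < 4 * k` and `k ≥ 4`; the rounding in `k / 4` is worst at `k = 7`, hence 28 for `n`.
  · have h := QuantumQuery.sqrt_mul_le_queries_of_cycles (α := k / 4) (by omega) (by omega) hn hA
    have h1 : √(k : ℝ) ≤ 3 * √((k / 4 : ℕ) : ℝ) := by
      rw [Real.sqrt_le_left (by positivity), mul_pow, Real.sq_sqrt (Nat.cast_nonneg _)]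
      have : k ≤ 9 * (k / 4) := by omega
      have : (k : ℝ) ≤ 9 * (k / 4 : ℕ) := by exact_mod_cast this
      linarith
    have h2 : (n : ℝ) ≤ 28 * (k / 4 : ℕ) := by
      have : n ≤ 28 * (k / 4) := by omega
      exact_mod_cast this
    have := mul_le_mul h1 h2 (Nat.cast_nonneg _) (by positivity)
    linarith
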